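/- For a tree $T$ and a set $S\subseteq V(T)$ let $d(S)$ be the least number of edges of a connected subgraph of $T$ containing $S$, and for a vertex $v$ let \[ d_k(v)=\sum_{S\subseteq V(T)\setminus\{v\},\ |S|=k-1} d(\{v\}\cup S) \] be its Steiner $k$-distance. A vertex is internal if its degree is at least $2$. For $2\le r\le n$, the $r$-comet on $n$ vertices is the tree obtained from a path with $r$ vertices by attaching $n-r$ leaves to one end vertex $d$ of the path; $b$ denotes the other end of the path and $c$ the neighbour of $b$ on the path. Theorem. Let $n\ge 4$ and $2\le k\le n$. For integers $1\le r\le n-2$ put \[ F(r) = 1 + \frac{\binom{n-2}{k}-\binom{n-r-2}{k}-\binom{r+1}{k}}{(n-r-2)\binom{n-2}{k-2}+(r+1)\binom{n-1}{k-1}+\binom{n-r-2}{k}-\binom{n-1}{k}}, \] and let $F=\max_{1\le r\le n-2}F(r)$. Then for every tree $T$ on $n$ vertices and all internal vertices $v,w$ of $T$, $d_k(w)>0$ and \[ \frac1F\le \frac{d_k(v)}{d_k(w)}\le F. \] Moreover, for every $r\in\{1,\dots,n-2\}$ with $F(r)=F$, the $(r+2)$-comet on $n$ vertices is a tree in which $\frac{d_k(c)}{d_k(d)}=F$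 and $\frac{d_k(d)}{d_k(c)}=\frac1F$, and if $r\le n-3$ then $c$ and $d$ are internal vertices of it. A maximiser $r$ of $F(r)$ with $1\le r\le n-3$ exists, so both bounds are attained by internal vertices. -/

import Mathlib

/-- The Steiner distance of a set `S` of vertices of `G`: the least number of edges of a connected
subgraph of `G` that contains `S`. -/
noncomputable def steinerDist {V : Type*} (G : SimpleGraph V) (S : Set V) : ℕ :=
  sInf {m : ℕ | ∃ H : G.Subgraph, H.Connected ∧ S ⊆ H.verts ∧ H.edgeSet.ncard = m}

/-- The Steiner `k`-distance of a vertex `v`: the sum of the Steiner distances of `{v} ∪ S` over all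
sets `S` of `k - 1` vertices that do not contain `v`. -/
noncomputable def steinerKDist {V : Type*} [Fintype V] [DecidableEq V] (G : SimpleGraph V)
    (k : ℕ) (v : V) : ℕ :=
  ∑ S ∈ Finset.powersetCard (k - 1) (Finset.univ.erase v),
    steinerDist G (insert v (S : Set V))

/-- Internal vertices: the vertices of degree at least two. -/
def IsInternal {V : Type*} (G : SimpleGraph V) (v : V) : Prop :=
  2 ≤ (G.neighborSet v).ncard

/-- The `r`-comet on `n` vertices (for `2 ≤ r ≤ n`): the path `0, 1, …, r - 1` of length `r - 1`,
together with `n - r` leaves `r, …, n - 1` attached to its end vertex `0`. -/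
def comet (n r : ℕ) : SimpleGraph (Fin n) :=
  SimpleGraph.fromRel fun i j : Fin n =>
    ((i : ℕ) + 1 = j ∧ (j : ℕ) < r) ∨ ((i : ℕ) = 0 ∧ r ≤ (j : ℕ))

/-- The vertex `d` of the `r`-comet: the end vertex of the path to which the leaves are attached. -/
def cometD (n r : ℕ) (h : 2 ≤ r ∧ r ≤ n) : Fin n := ⟨0, by omega⟩

/-- The vertex `c` of the `r`-comet: the neighbour on the path of its other end vertex
`b = r - 1`. -/
def cometC (n r : ℕ) (h : 2 ≤ r ∧ r ≤ n) : Fin n := ⟨r - 2, by omega⟩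

/-- The binomial expression to be maximised over `1 ≤ r ≤ n - 2`. -/
noncomputable def boundF (n k r : ℕ) : ℝ :=
  1 + (((n - 2).choose k : ℝ) - ((n - r - 2).choose k : ℝ) - ((r + 1).choose k : ℝ)) /
    (((n : ℝ) - r - 2) * ((n - 2).choose (k - 2) : ℝ)
      + ((r : ℝ) + 1) * ((n - 1).choose (k - 1) : ℝ)
      + ((n - r - 2).choose k : ℝ) - ((n - 1).choose k : ℝ))

/-! Root a tree at `v`. The smallest subtree containing `v` and `S` consists of `v` and the vertices
`u` whose branch meets `S`, and each such `u ≠ v` contributes one edge. Summing over `S` makes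
`d_k(v)` a sum over `u ≠ v` of `meetCount`, an increasing function of branch size
(`SimpleGraph.IsTree.steinerKDist_eq`). Moving the root across an edge changes only the terms of its
two ends, whose branches have sizes `m` and `n - m`.

Let `w = x 0, …, x r = v` be a path. As `v` is internal, the path extends to some `x (r + 1)`, so
the branch of `x i` has at least `r + 2 - i` vertices. Monotonicity then bounds `d_k(v) - d_k(w)`
above by `cometNum` and `d_k(w)` below by `cometDen`, whence the ratio is at most `max 1 F(r)`. In
the `(r + 2)`-comet all these estimates are equalities. Since `F(1) ≥ 1`, the `1` disappears at a
maximiser, and swapping `v` and `w` gives the lower bound. -/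

open Finset in
/-- The vertices that every walk from `v` can only reach through `u`. In a tree rooted at `v` these
are the descendants of `u`. -/
noncomputable def branch {V : Type*} [Fintype V] (G : SimpleGraph V) (v u : V) : Finset V :=
  open Classical in univ.filter fun x => ∀ p : G.Walk v x, u ∈ p.support

/-- The number of `(k - 1)`-subsets of an `(n - 1)`-set that meet a given `m`-subset. -/
noncomputable def meetCount (n k m : ℕ) : ℝ :=
  ((n - 1).choose (k - 1) : ℝ) - ((n - 1 - m).choose (k - 1) : ℝ)

/-! ### Branches of a rooted tree. -/

section Branch

variable {V : Type*} [Fintype V] {G : SimpleGraph V}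

theorem mem_branch {v u x : V} : x ∈ branch G v u ↔ ∀ p : G.Walk v x, u ∈ p.support := by
  simp [branch]

theorem self_mem_branch (v u : V) : u ∈ branch G v u :=
  mem_branch.2 fun p => p.end_mem_support

theorem root_notMem_branch {v u : V} (h : u ≠ v) : v ∉ branch G v u := fun hv => by
  simpa [h] using mem_branch.1 hv SimpleGraph.Walk.nil

theorem SimpleGraph.IsAcyclic.mem_support_of_isPath {V : Type*} {G : SimpleGraph V}
    (hG : G.IsAcyclic) {v x u : V} {p : G.Walk v x} (hp : p.IsPath) (hu : u ∈ p.support)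
    (q : G.Walk v x) : u ∈ q.support := by
  classical
  have := hG.subsingleton_path v x
  have h : p = q.bypass := congrArg Subtype.val (Subsingleton.elim (⟨p, hp⟩ : G.Path v x) q.toPath)
  exact q.support_bypass_subset_support (h ▸ hu)

theorem SimpleGraph.IsAcyclic.mem_branch_iff (hG : G.IsAcyclic) {v x u : V} {p : G.Walk v x}
    (hp : p.IsPath) : x ∈ branch G v u ↔ u ∈ p.support :=
  ⟨fun h => mem_branch.1 h p, fun h => mem_branch.2 (hG.mem_support_of_isPath hp h)⟩

/-- Moving the root along a walk only affects the branches at vertices of that walk. -/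
theorem branch_subset_of_notMem_support {v w u : V} (p : G.Walk v w) (hu : u ∉ p.support) :
    branch G v u ⊆ branch G w u := fun x hx => mem_branch.2 fun q => by
  have := mem_branch.1 hx (p.append q)
  rw [SimpleGraph.Walk.mem_support_append_iff] at this
  exact this.resolve_left hu

theorem branch_eq_of_notMem_support {v w u : V} (p : G.Walk v w) (hu : u ∉ p.support) :
    branch G v u = branch G w u :=
  (branch_subset_of_notMem_support p hu).antisymm
    (branch_subset_of_notMem_support p.reverse (by simpa using hu))

/-- The two branches at an edge of a tree partition the vertices. -/
theorem SimpleGraph.IsTree.mem_branch_adj_iff (hG : G.IsTree) {a b : V} (hab : G.Adj a b)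
    (x : V) : x ∈ branch G a b ↔ x ∉ branch G b a := by
  obtain ⟨p, hp, -⟩ := hG.existsUnique_path x a
  obtain ⟨q, hq, -⟩ := hG.existsUnique_path x b
  rw [hG.isAcyclic.mem_branch_iff hp.reverse, hG.isAcyclic.mem_branch_iff hq.reverse]
  simp only [SimpleGraph.Walk.support_reverse, List.mem_reverse]
  -- Exactly one of the paths from `x` to `a` and to `b` runs through the other end of the edge.
  exact ⟨hG.isAcyclic.ne_mem_support_of_support_of_adj_of_isPath hp hq hab,
    hG.isAcyclic.mem_support_of_ne_mem_support_of_adj_of_isPath hp hq hab⟩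

theorem SimpleGraph.IsTree.card_branch_adj (hG : G.IsTree) {a b : V} (hab : G.Adj a b) :
    (branch G b a).card = Fintype.card V - (branch G a b).card := by
  classical
  rw [← Finset.card_compl]
  congr 1
  ext x
  rw [Finset.mem_compl, hG.mem_branch_adj_iff hab, not_not]

end Branch

open Classical in
theorem card_filter_powersetCard_meets {V : Type*} [DecidableEq V] (A B : Finset V) (hB : B ⊆ A) (j : ℕ) :
    (({S ∈ A.powersetCard j | ∃ s ∈ S, s ∈ B}.card : ℕ) : ℝ) =
      (A.card.choose j : ℝ) - ((A.card - B.card).choose j : ℝ) := by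
  have h1 := Finset.card_filter_add_card_filter_not (s := A.powersetCard j)
    (fun S => ∃ s ∈ S, s ∈ B)
  have h2 : {S ∈ A.powersetCard j | ¬ ∃ s ∈ S, s ∈ B} = (A \ B).powersetCard j := by
    ext S
    simp only [Finset.mem_filter, Finset.mem_powersetCard, Finset.subset_sdiff,
      Finset.disjoint_left]
    push Not
    tauto
  rw [h2, Finset.card_powersetCard, Finset.card_powersetCard,
    Finset.card_sdiff_of_subset hB] at h1
  rw [eq_sub_iff_add_eq]
  exact_mod_cast h1

/-! ### Steiner distances as sums over branches. -/

section Steiner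

variable {V : Type*} {G : SimpleGraph V}

theorem SimpleGraph.IsAcyclic.ncard_edgeSet_subgraph [Finite V] (hG : G.IsAcyclic)
    {H : G.Subgraph} (hH : H.Connected) : H.edgeSet.ncard + 1 = H.verts.ncard := by
  have hT : H.coe.IsTree := ⟨hH.coe, hG.subgraph H⟩
  have := (SimpleGraph.isTree_iff_connected_and_card.1 hT).2
  rw [← H.image_coe_edgeSet_coe,
    Set.ncard_image_of_injective _ (Sym2.map.injective Subtype.val_injective)]
  exact this

variable [Fintype V] [DecidableEq V]

-- The vertices counted, together with `v`, span the union of the paths from `v` to `S`, which is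
-- connected; every connected subgraph containing `v` and `S` contains them all.
open Classical in
theorem SimpleGraph.IsTree.steinerDist_insert (hG : G.IsTree) (v : V) (S : Finset V) :
    steinerDist G (insert v (S : Set V)) =
      {u ∈ Finset.univ.erase v | ∃ s ∈ S, s ∈ branch G v u}.card := by
  set A : Finset V := {u ∈ Finset.univ.erase v | ∃ s ∈ S, s ∈ branch G v u} with hA
  set U : Finset V := insert v A with hU
  have hUcard : U.card = A.card + 1 := Finset.card_insert_of_notMem (by simp [hA])
  have hlow : ∀ H : G.Subgraph, H.Connected → insert v (S : Set V) ⊆ H.verts →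
      (U : Set V) ⊆ H.verts := by
    intro H hH hS u hu
    have hv : v ∈ H.verts := hS (by simp)
    simp only [hU, Finset.coe_insert, Set.mem_insert_iff, Finset.mem_coe] at hu
    rcases hu with rfl | hu
    · exact hv
    simp only [hA, Finset.mem_filter] at hu
    obtain ⟨-, s, hs, hsu⟩ := hu
    -- A walk from `v` to `s` inside `H` must visit `u`, so `u` lies in `H`.
    obtain ⟨p⟩ := hH.coe ⟨v, hv⟩ ⟨s, hS (by simp [hs])⟩
    have h : u ∈ (p.map H.hom).support := mem_branch.1 hsu (p.map H.hom)
    rw [SimpleGraph.Walk.support_map, List.mem_map] at h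
    obtain ⟨y, -, rfl⟩ := h
    exact y.2
  have hc : ((⊤ : G.Subgraph).induce (U : Set V)).Connected := by
    rw [← SimpleGraph.connected_induce_iff]
    refine G.induce_connected_of_patches v (by simp [hU]) ?_
    intro u hu
    have key : ∃ s, (∃ q : G.Walk v s, q.IsPath ∧ u ∈ q.support) ∧ (s = v ∨ s ∈ S) := by
      simp only [hU, Finset.coe_insert, Set.mem_insert_iff, Finset.mem_coe] at hu
      rcases hu with rfl | hu
      · exact ⟨u, ⟨.nil, by simp, by simp⟩, Or.inl rfl⟩
      · simp only [hA, Finset.mem_filter] at hu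
        obtain ⟨-, s, hs, hsu⟩ := hu
        obtain ⟨q, hq, -⟩ := hG.existsUnique_path v s
        exact ⟨s, ⟨q, hq, mem_branch.1 hsu q⟩, Or.inr hs⟩
    obtain ⟨s, ⟨q, hq, huq⟩, hs⟩ := key
    refine ⟨{y | y ∈ q.support}, ?_, q.start_mem_support, huq, q.connected_induce_support _ _⟩
    intro y hy
    by_cases hyv : y = v
    · simp [hU, hyv]
    rcases hs with rfl | hs
    · have : q = .nil := SimpleGraph.Walk.eq_nil_iff_nil.2 (SimpleGraph.Walk.isPath_iff_nil.1 hq)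
      subst this
      simp at hy
      exact absurd hy hyv
    · simp only [hU, Finset.coe_insert, Set.mem_insert_iff, Finset.mem_coe, hA,
        Finset.mem_filter]
      exact Or.inr ⟨by simp [hyv], s, hs, (hG.isAcyclic.mem_branch_iff hq).2 hy⟩
  refine le_antisymm (Nat.sInf_le ?_) (le_csInf ?_ ?_)
  · refine ⟨(⊤ : G.Subgraph).induce (U : Set V), hc, ?_, ?_⟩
    · intro s hs
      simp only [SimpleGraph.Subgraph.induce_verts, hU, Finset.coe_insert]
      rcases hs with rfl | hs
      · simp
      · by_cases hsv : s = v
        · simp [hsv]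
        · refine Or.inr ?_
          simp only [hA, Finset.mem_coe, Finset.mem_filter]
          exact ⟨by simp [hsv], s, hs, self_mem_branch v s⟩
    · have := hG.isAcyclic.ncard_edgeSet_subgraph hc
      rw [SimpleGraph.Subgraph.induce_verts, Set.ncard_coe_finset] at this
      omega
  · have : Nonempty V := ⟨v⟩
    exact ⟨_, ⊤, ⟨SimpleGraph.Subgraph.topIso.connected_iff.2 hG.connected⟩, by simp, rfl⟩
  · rintro m ⟨H, hH, hS, rfl⟩
    have h1 := hG.isAcyclic.ncard_edgeSet_subgraph hH
    have h2 := Set.ncard_le_ncard (hlow H hH hS) (Set.toFinite _)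
    rw [Set.ncard_coe_finset] at h2
    omega

/-- Double counting: exchange the sums over `S` and over `u`. -/
theorem SimpleGraph.IsTree.steinerKDist_eq (hG : G.IsTree) (k : ℕ) (v : V) :
    (steinerKDist G k v : ℝ) =
      ∑ u ∈ Finset.univ.erase v, meetCount (Fintype.card V) k (branch G v u).card := by
  classical
  unfold steinerKDist
  simp_rw [hG.steinerDist_insert, Finset.card_filter]
  rw [Finset.sum_comm]
  push_cast
  refine Finset.sum_congr rfl fun u hu => ?_
  have hB : branch G v u ⊆ Finset.univ.erase v := fun x hx =>
    Finset.mem_erase.2 ⟨fun h => root_notMem_branch (Finset.ne_of_mem_erase hu) (h ▸ hx),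
      Finset.mem_univ _⟩
  have := card_filter_powersetCard_meets _ _ hB (k - 1)
  rw [Finset.card_erase_of_mem (Finset.mem_univ _), Finset.card_univ] at this
  rw [meetCount, ← this, Finset.card_filter]
  push_cast
  rfl

/-- Branches at vertices other than `a` and `b` are the same from either root, so their terms
cancel. -/
theorem SimpleGraph.IsTree.steinerKDist_adj (hG : G.IsTree) (k : ℕ) {a b : V}
    (hab : G.Adj a b) :
    (steinerKDist G k b : ℝ) = steinerKDist G k a +
      (meetCount (Fintype.card V) k (Fintype.card V - (branch G a b).card) -
        meetCount (Fintype.card V) k (branch G a b).card) := by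
  have ha : b ∈ Finset.univ.erase a := by simp [hab.ne']
  have hb : a ∈ Finset.univ.erase b := by simp [hab.ne]
  rw [hG.steinerKDist_eq, hG.steinerKDist_eq, ← Finset.add_sum_erase _ _ ha,
    ← Finset.add_sum_erase _ _ hb, hG.card_branch_adj hab, Finset.erase_right_comm]
  have : ∀ u ∈ (Finset.univ.erase a).erase b, branch G b u = branch G a u := fun u hu =>
    branch_eq_of_notMem_support hab.symm.toWalk (by
      simp only [Finset.mem_erase] at hu
      simp [hu.1, hu.2.1])
  rw [Finset.sum_congr rfl fun u hu => by rw [this u hu]]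
  ring

end Steiner
-- Branches and Steiner distances along a path.
section Path

open Finset

variable {V : Type*} {G : SimpleGraph V} {x : ℕ → V} {L : ℕ}

theorem exists_isPath_of_injOn (hadj : ∀ i < L, G.Adj (x i) (x (i + 1)))
    (hinj : Set.InjOn x (Set.Iic L)) {j : ℕ} (hj : j ≤ L) :
    ∃ p : G.Walk (x 0) (x j), p.IsPath ∧ ∀ u, u ∈ p.support ↔ ∃ i ≤ j, x i = u := by
  induction j with
  | zero => exact ⟨.nil, by simp, by simp [eq_comm]⟩
  | succ j ih =>
    obtain ⟨p, hp, hs⟩ := ih (by omega)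
    refine ⟨p.concat (hadj j (by omega)), hp.concat ?_ _, fun u => ?_⟩
    · rw [hs]
      rintro ⟨i, hi, h⟩
      have := hinj (Set.mem_Iic.2 (by omega)) (Set.mem_Iic.2 hj) h
      omega
    · rw [SimpleGraph.Walk.support_concat, List.mem_append, hs,
        List.mem_singleton]
      constructor
      · rintro (⟨i, hi, h⟩ | rfl)
        · exact ⟨i, by omega, h⟩
        · exact ⟨j + 1, le_rfl, rfl⟩
      · rintro ⟨i, hi, rfl⟩
        rcases Nat.lt_or_ge j i with h | h
        · exact Or.inr (by rw [show i = j + 1 by omega])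
        · exact Or.inl ⟨i, h, rfl⟩

variable [Fintype V]

theorem SimpleGraph.IsAcyclic.mem_branch_path_iff (hG : G.IsAcyclic)
    (hadj : ∀ i < L, G.Adj (x i) (x (i + 1))) (hinj : Set.InjOn x (Set.Iic L)) {i j : ℕ}
    (hi : i ≤ L) (hj : j ≤ L) : x j ∈ branch G (x 0) (x i) ↔ i ≤ j := by
  obtain ⟨p, hp, hs⟩ := exists_isPath_of_injOn hadj hinj hj
  rw [hG.mem_branch_iff hp, hs]
  constructor
  · rintro ⟨l, hl, h⟩
    have := hinj (Set.mem_Iic.2 (hl.trans hj)) (Set.mem_Iic.2 hi) h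
    omega
  · exact fun h => ⟨i, h, rfl⟩

theorem SimpleGraph.IsAcyclic.le_card_branch_path (hG : G.IsAcyclic)
    (hadj : ∀ i < L, G.Adj (x i) (x (i + 1))) (hinj : Set.InjOn x (Set.Iic L)) {i : ℕ}
    (hi : i ≤ L) : L + 1 - i ≤ (branch G (x 0) (x i)).card := by
  classical
  rw [← Nat.card_Icc, ← card_image_of_injOn (f := x) (s := Icc i L)
    (hinj.mono fun j hj => (mem_Icc.1 hj).2)]
  refine card_le_card fun y hy => ?_
  obtain ⟨j, hj, rfl⟩ := mem_image.1 hy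
  rw [mem_Icc] at hj
  exact (hG.mem_branch_path_iff hadj hinj hi hj.2).2 hj.1

/-- Lets all the edge steps along the path be expressed with the single root `x 0`. -/
theorem branch_path_eq (hadj : ∀ i < L, G.Adj (x i) (x (i + 1)))
    (hinj : Set.InjOn x (Set.Iic L)) {i : ℕ} (hi : i < L) :
    branch G (x i) (x (i + 1)) = branch G (x 0) (x (i + 1)) := by
  obtain ⟨p, hp, hs⟩ := exists_isPath_of_injOn hadj hinj hi.le
  refine (branch_eq_of_notMem_support p ?_).symm
  rw [hs]
  rintro ⟨l, hl, h⟩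
  have := hinj (Set.mem_Iic.2 (by omega)) (Set.mem_Iic.2 (by omega)) h
  omega

variable [DecidableEq V]

/-- The change of the Steiner `k`-distance along a path. -/
theorem SimpleGraph.IsTree.steinerKDist_path (hG : G.IsTree) (k : ℕ)
    (hadj : ∀ i < L, G.Adj (x i) (x (i + 1))) (hinj : Set.InjOn x (Set.Iic L)) {r : ℕ}
    (hr : r ≤ L) :
    (steinerKDist G k (x r) : ℝ) = steinerKDist G k (x 0) +
      ∑ i ∈ range r,
        (meetCount (Fintype.card V) k (Fintype.card V - (branch G (x 0) (x (i + 1))).card) -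
          meetCount (Fintype.card V) k (branch G (x 0) (x (i + 1))).card) := by
  induction r with
  | zero => simp
  | succ r ih =>
    rw [sum_range_succ, hG.steinerKDist_adj k (hadj r hr), ih (by omega),
      branch_path_eq hadj hinj hr]
    ring

theorem SimpleGraph.IsTree.steinerKDist_path_start (hG : G.IsTree) (k : ℕ)
    (hinj : Set.InjOn x (Set.Iic L)) {r : ℕ} (hr : r ≤ L) :
    (steinerKDist G k (x 0) : ℝ) =
      ∑ i ∈ range r, meetCount (Fintype.card V) k (branch G (x 0) (x (i + 1))).card +
      ∑ u ∈ univ \ (range (r + 1)).image x,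
        meetCount (Fintype.card V) k (branch G (x 0) u).card := by
  have himg : (range (r + 1)).image x = insert (x 0) ((range r).image fun i => x (i + 1)) := by
    ext u
    simp only [mem_image, mem_insert, mem_range]
    constructor
    · rintro ⟨_ | i, hi, rfl⟩
      · exact Or.inl rfl
      · exact Or.inr ⟨i, by omega, rfl⟩
    · rintro (rfl | ⟨i, hi, rfl⟩)
      · exact ⟨0, by omega, rfl⟩
      · exact ⟨i + 1, by omega, rfl⟩
  have hsub : (range r).image (fun i => x (i + 1)) ⊆ univ.erase (x 0) := by
    intro u hu
    obtain ⟨i, hi, rfl⟩ := mem_image.1 hu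
    rw [mem_range] at hi
    refine mem_erase.2 ⟨fun h => ?_, mem_univ _⟩
    have := hinj (Set.mem_Iic.2 (by omega)) (Set.mem_Iic.2 (by omega)) h
    omega
  have hset : univ \ (range (r + 1)).image x =
      univ.erase (x 0) \ (range r).image (fun i => x (i + 1)) := by
    rw [himg]
    ext u
    simp only [mem_sdiff, mem_insert, mem_erase, mem_univ]
    tauto
  rw [hG.steinerKDist_eq, hset, ← sum_sdiff hsub, add_comm, sum_image]
  intro i hi j hj h
  have hi := mem_range.1 hi
  have hj := mem_range.1 hj
  have := hinj (Set.mem_Iic.2 (by omega)) (Set.mem_Iic.2 (by omega)) h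
  omega

theorem card_univ_sdiff_path (hinj : Set.InjOn x (Set.Iic L)) {r : ℕ} (hr : r ≤ L) :
    (univ \ (range (r + 1)).image x).card + (r + 1) = Fintype.card V := by
  have h : ((range (r + 1)).image x).card = r + 1 := by
    rw [card_image_of_injOn, card_range]
    exact hinj.mono fun i hi => Set.mem_Iic.2 (by have := mem_range.1 hi; omega)
  have := card_sdiff_add_card_eq_card (subset_univ ((range (r + 1)).image x))
  rwa [h, card_univ] at this

end Path

/-! ### Binomial identities and the closed form of `boundF`. -/

section Counting

open Finset

theorem meetCount_mono (n k : ℕ) : Monotone (meetCount n k) := fun a b h => by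
  have : (n - 1 - b).choose (k - 1) ≤ (n - 1 - a).choose (k - 1) :=
    Nat.choose_le_choose _ (by omega)
  have : ((n - 1 - b).choose (k - 1) : ℝ) ≤ (n - 1 - a).choose (k - 1) := by exact_mod_cast this
  simp only [meetCount]
  linarith

theorem meetCount_one {n k : ℕ} (hn : 2 ≤ n) (hk : 2 ≤ k) :
    meetCount n k 1 = (n - 2).choose (k - 2) := by
  obtain ⟨n, rfl⟩ := Nat.exists_eq_add_of_le hn
  obtain ⟨k, rfl⟩ := Nat.exists_eq_add_of_le hk
  simp only [meetCount, show 2 + n - 1 = n + 1 by omega, show 2 + k - 1 = k + 1 by omega,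
    show n + 1 - 1 = n by omega, show 2 + n - 2 = n by omega, show 2 + k - 2 = k by omega,
    Nat.choose_succ_succ]
  push_cast
  ring

theorem meetCount_one_pos {n k : ℕ} (hn : 2 ≤ n) (hk : 2 ≤ k) (hkn : k ≤ n) :
    0 < meetCount n k 1 := by
  rw [meetCount_one hn hk]
  exact_mod_cast Nat.choose_pos (by omega)

theorem meetCount_pos {n k m : ℕ} (hn : 2 ≤ n) (hk : 2 ≤ k) (hkn : k ≤ n) (hm : 1 ≤ m) :
    0 < meetCount n k m :=
  (meetCount_one_pos hn hk hkn).trans_le (meetCount_mono n k hm)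

theorem sum_range_choose_add_one {k : ℕ} (hk : 2 ≤ k) (r : ℕ) :
    ∑ j ∈ range r, ((j + 1).choose (k - 1) : ℝ) = (r + 1).choose k := by
  obtain ⟨k, rfl⟩ := Nat.exists_eq_add_of_le hk
  induction r with
  | zero =>
    -- `2 ≤ k` makes the starting value `1.choose k` of this hockey-stick sum vanish.
    rw [Nat.choose_eq_zero_of_lt (by omega)]
    simp
  | succ r ih =>
    rw [sum_range_succ, ih, show 2 + k = k + 1 + 1 by omega, Nat.choose_succ_succ (r + 1)]
    push_cast
    ring

theorem sum_range_choose_sub {n k r : ℕ} (hk : 1 ≤ k) (hr : r ≤ n) :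
    ∑ j ∈ range r, ((n - 1 - j).choose (k - 1) : ℝ) = n.choose k - (n - r).choose k := by
  obtain ⟨k, rfl⟩ := Nat.exists_eq_add_of_le hk
  induction r with
  | zero => simp
  | succ r ih =>
    obtain ⟨m, hm⟩ : ∃ m, n - r = m + 1 := ⟨n - r - 1, by omega⟩
    rw [sum_range_succ, ih (by omega), hm, show n - 1 - r = m by omega,
      show n - (r + 1) = m by omega, show 1 + k = k + 1 by omega, Nat.choose_succ_succ m]
    push_cast
    simp only [Nat.succ_eq_add_one]
    ring

/-- The Steiner `k`-distance of the vertex `d` of the `(r + 2)`-comet. -/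
noncomputable def cometDen (n k r : ℕ) : ℝ :=
  ∑ i ∈ range r, meetCount n k (r + 1 - i) + ((n : ℝ) - (r + 1)) * meetCount n k 1

/-- The difference of the Steiner `k`-distances of `c` and `d` in the `(r + 2)`-comet. -/
noncomputable def cometNum (n k r : ℕ) : ℝ :=
  ∑ i ∈ range r, (meetCount n k (n - (r + 1 - i)) - meetCount n k (r + 1 - i))

theorem sum_meetCount_eq {n k r : ℕ} (hk : 2 ≤ k) (hr : r ≤ n - 2) :
    ∑ i ∈ range r, meetCount n k (r + 1 - i) =
      r * ((n - 1).choose (k - 1) : ℝ) - ((n - 2).choose k - (n - r - 2).choose k) := by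
  -- Reversal lists the branch sizes as `2, …, r + 1`, so the subtracted binomials telescope.
  rw [← sum_range_reflect, show n - r - 2 = n - 2 - r by omega,
    ← sum_range_choose_sub (by omega : 1 ≤ k) hr,
    show (r : ℝ) * ((n - 1).choose (k - 1) : ℝ) = ∑ _j ∈ range r, ((n - 1).choose (k - 1) : ℝ) by
      simp, ← sum_sub_distrib]
  refine sum_congr rfl fun j hj => ?_
  have := mem_range.1 hj
  rw [meetCount, show n - 1 - (r + 1 - (r - 1 - j)) = n - 2 - 1 - j by omega]

theorem sum_meetCount_sub_eq {n k r : ℕ} (hk : 2 ≤ k) (hr : r ≤ n - 2) :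
    ∑ i ∈ range r, meetCount n k (n - (r + 1 - i)) =
      r * ((n - 1).choose (k - 1) : ℝ) - (r + 1).choose k := by
  rw [← sum_range_reflect, ← sum_range_choose_add_one hk,
    show (r : ℝ) * ((n - 1).choose (k - 1) : ℝ) = ∑ _j ∈ range r, ((n - 1).choose (k - 1) : ℝ) by
      simp, ← sum_sub_distrib]
  refine sum_congr rfl fun j hj => ?_
  have := mem_range.1 hj
  rw [meetCount, show n - 1 - (n - (r + 1 - (r - 1 - j))) = j + 1 by omega]

theorem boundF_eq {n k r : ℕ} (hn : 2 ≤ n) (hk : 2 ≤ k) (hr : r ≤ n - 2) :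
    boundF n k r = 1 + cometNum n k r / cometDen n k r := by
  have h1 : (n - 1).choose (k - 1) = (n - 2).choose (k - 2) + (n - 2).choose (k - 1) := by
    obtain ⟨n, rfl⟩ := Nat.exists_eq_add_of_le hn
    obtain ⟨k, rfl⟩ := Nat.exists_eq_add_of_le hk
    rw [show 2 + n - 1 = n + 1 by omega, show 2 + k - 1 = k + 1 by omega,
      Nat.choose_succ_succ]
    simp
  have h2 : (n - 1).choose k = (n - 2).choose (k - 1) + (n - 2).choose k := by
    obtain ⟨n, rfl⟩ := Nat.exists_eq_add_of_le hn
    obtain ⟨k, rfl⟩ := Nat.exists_eq_add_of_le hk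
    rw [show 2 + n - 1 = n + 1 by omega, show 2 + k = k + 1 + 1 by omega,
      Nat.choose_succ_succ]
    simp
  have h1' : ((n - 1).choose (k - 1) : ℝ) = (n - 2).choose (k - 2) + (n - 2).choose (k - 1) := by
    exact_mod_cast h1
  have h2' : ((n - 1).choose k : ℝ) = (n - 2).choose (k - 1) + (n - 2).choose k := by
    exact_mod_cast h2
  rw [boundF, cometNum, cometDen, sum_sub_distrib, sum_meetCount_eq hk hr,
    sum_meetCount_sub_eq hk hr, meetCount_one hn hk]
  congr 2
  · ring
  · rw [h2']
    linear_combination h1'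

theorem cometDen_pos {n k r : ℕ} (hn : 2 ≤ n) (hk : 2 ≤ k) (hkn : k ≤ n) (hr : r ≤ n - 2) :
    0 < cometDen n k r := by
  have : (r : ℝ) + 2 ≤ n := by exact_mod_cast (by omega : r + 2 ≤ n)
  refine add_pos_of_nonneg_of_pos (sum_nonneg fun i hi => ?_)
    (mul_pos (by linarith) (meetCount_one_pos hn hk hkn))
  have := mem_range.1 hi
  exact (meetCount_pos hn hk hkn (by omega)).le

theorem one_le_boundF_one {n k : ℕ} (hn : 4 ≤ n) (hk : 2 ≤ k) (hkn : k ≤ n) :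
    1 ≤ boundF n k 1 := by
  rw [boundF_eq (by omega) hk (by omega), le_add_iff_nonneg_right]
  refine div_nonneg ?_ (cometDen_pos (by omega) hk hkn (by omega)).le
  simp only [cometNum, range_one, sum_singleton, sub_nonneg]
  -- The single term compares branch sizes `2` and `n - 2`; this is where `4 ≤ n` enters.
  exact meetCount_mono n k (by omega)

theorem boundF_sub_two_le_one {n k : ℕ} (hn : 4 ≤ n) (hk : 2 ≤ k) (hkn : k ≤ n) :
    boundF n k (n - 2) ≤ 1 := by
  rw [boundF_eq (by omega) hk le_rfl, add_le_iff_nonpos_right]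
  refine div_nonpos_of_nonpos_of_nonneg ?_ (cometDen_pos (by omega) hk hkn le_rfl).le
  rw [cometNum, sum_sub_distrib, sum_meetCount_eq hk le_rfl, sum_meetCount_sub_eq hk le_rfl,
    show n - (n - 2) - 2 = 0 by omega, Nat.choose_eq_zero_of_lt (show 0 < k by omega)]
  have : (n - 2).choose k ≤ (n - 2 + 1).choose k := Nat.choose_le_choose _ (by omega)
  have : ((n - 2).choose k : ℝ) ≤ (n - 2 + 1).choose k := by exact_mod_cast this
  push_cast
  linarith

end Counting

/-- A nontrivial path ending in an internal vertex of a tree can be extended. -/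
theorem SimpleGraph.IsTree.exists_path_extending {V : Type*}
    {G : SimpleGraph V} (hG : G.IsTree) {v w : V} (hvw : v ≠ w)
    (hv : IsInternal G v) : ∃ (r : ℕ) (x : ℕ → V), 1 ≤ r ∧ x 0 = w ∧ x r = v ∧
      (∀ i < r + 1, G.Adj (x i) (x (i + 1))) ∧ Set.InjOn x (Set.Iic (r + 1)) := by
  obtain ⟨p, hp, -⟩ := hG.existsUnique_path w v
  obtain ⟨y, hy, hne⟩ := Set.exists_ne_of_one_lt_ncard (s := G.neighborSet v) hv p.penultimate
  have hyp : y ∉ p.support := fun h =>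
    -- The only neighbour of `v` on the path is its penultimate vertex, which `y` avoids.
    hne (hG.isAcyclic.eq_penultimate_of_adj_end hp hy h)
  have hq := hp.concat hyp hy
  set q := p.concat hy with hqdef
  have hlen : q.length = p.length + 1 := p.length_concat hy
  refine ⟨p.length, q.getVert, ?_, q.getVert_zero, ?_, fun i hi => ?_, ?_⟩
  · rw [Nat.one_le_iff_ne_zero]
    exact fun h => hvw (SimpleGraph.Walk.eq_of_length_eq_zero h).symm
  · simp [hqdef, SimpleGraph.Walk.concat, SimpleGraph.Walk.getVert_append]
  · exact q.adj_getVert_succ (by omega)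
  · rw [← hlen]
    exact hq.getVert_injOn

/-! ### The upper bound for the ratio in a general tree. -/

section Bound

open Finset

variable {V : Type*} [Fintype V] [DecidableEq V] {G : SimpleGraph V}

theorem SimpleGraph.IsTree.steinerKDist_pos (hG : G.IsTree) {k : ℕ} (hk : 2 ≤ k)
    (hn : 2 ≤ Fintype.card V) (hkn : k ≤ Fintype.card V) (v : V) : 0 < steinerKDist G k v := by
  have : (0 : ℝ) < steinerKDist G k v := by
    rw [hG.steinerKDist_eq]
    refine sum_pos (fun u _ => meetCount_pos hn hk hkn (card_pos.2 ⟨u, self_mem_branch v u⟩)) ?_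
    rw [← card_pos, card_erase_of_mem (mem_univ _), card_univ]
    omega
  exact_mod_cast this

variable {x : ℕ → V} {r : ℕ}

theorem SimpleGraph.IsTree.steinerKDist_path_le (hG : G.IsTree) (k : ℕ)
    (hadj : ∀ i < r + 1, G.Adj (x i) (x (i + 1))) (hinj : Set.InjOn x (Set.Iic (r + 1))) :
    (steinerKDist G k (x r) : ℝ) ≤ steinerKDist G k (x 0) + cometNum (Fintype.card V) k r := by
  rw [hG.steinerKDist_path k hadj hinj (by omega : r ≤ r + 1), cometNum]
  refine add_le_add_right (sum_le_sum fun i hi => ?_) _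
  have := mem_range.1 hi
  have h := hG.isAcyclic.le_card_branch_path hadj hinj (i := i + 1) (by omega)
  exact sub_le_sub (meetCount_mono _ k (by omega)) (meetCount_mono _ k (by omega))

theorem SimpleGraph.IsTree.cometDen_le_steinerKDist (hG : G.IsTree) (k : ℕ)
    (hadj : ∀ i < r + 1, G.Adj (x i) (x (i + 1))) (hinj : Set.InjOn x (Set.Iic (r + 1))) :
    cometDen (Fintype.card V) k r ≤ steinerKDist G k (x 0) := by
  rw [hG.steinerKDist_path_start k hinj (by omega : r ≤ r + 1), cometDen]
  refine add_le_add (sum_le_sum fun i hi => ?_) ?_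
  · have := mem_range.1 hi
    have h := hG.isAcyclic.le_card_branch_path hadj hinj (i := i + 1) (by omega)
    exact meetCount_mono _ k (by omega)
  · have h := card_univ_sdiff_path hinj (by omega : r ≤ r + 1)
    have h' : ((univ \ (range (r + 1)).image x).card : ℝ) = (Fintype.card V : ℝ) - (r + 1) := by
      rw [← h]
      push_cast
      ring
    rw [← h', ← nsmul_eq_mul]
    exact card_nsmul_le_sum _ _ _ fun u _ =>
      meetCount_mono _ k (card_pos.2 ⟨u, self_mem_branch _ u⟩)

/-- Replacing the denominator by `cometDen` increases the bound only if `cometNum` is nonnegative;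
otherwise the ratio is at most `1`, hence the `max`. -/
theorem SimpleGraph.IsTree.steinerKDist_div_le (hG : G.IsTree) {k : ℕ} (hk : 2 ≤ k)
    (hn : 2 ≤ Fintype.card V) (hkn : k ≤ Fintype.card V)
    (hadj : ∀ i < r + 1, G.Adj (x i) (x (i + 1))) (hinj : Set.InjOn x (Set.Iic (r + 1))) :
    (steinerKDist G k (x r) : ℝ) / steinerKDist G k (x 0) ≤
      max 1 (boundF (Fintype.card V) k r) := by
  have hr : r ≤ Fintype.card V - 2 := by
    have := card_univ_sdiff_path hinj le_rfl
    omega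
  have h1 := hG.steinerKDist_path_le k hadj hinj
  have h2 := hG.cometDen_le_steinerKDist k hadj hinj
  have h3 := cometDen_pos hn hk hkn hr
  have h4 := h3.trans_le h2
  rcases le_total (cometNum (Fintype.card V) k r) 0 with h | h
  · exact le_max_of_le_left ((div_le_one h4).2 (by linarith))
  · refine le_max_of_le_right ?_
    rw [boundF_eq hn hk hr]
    calc _ ≤ ((steinerKDist G k (x 0) : ℝ) + cometNum (Fintype.card V) k r) /
          steinerKDist G k (x 0) := by gcongr
      _ = 1 + cometNum (Fintype.card V) k r / steinerKDist G k (x 0) := by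
          rw [add_div, div_self h4.ne']
      _ ≤ _ := by gcongr

theorem SimpleGraph.IsTree.exists_steinerKDist_div_le (hG : G.IsTree) {k : ℕ} (hk : 2 ≤ k)
    (hn : 4 ≤ Fintype.card V) (hkn : k ≤ Fintype.card V) {v : V} (w : V)
    (hv : IsInternal G v) : ∃ r ∈ Set.Icc 1 (Fintype.card V - 2),
      (steinerKDist G k v : ℝ) / steinerKDist G k w ≤ max 1 (boundF (Fintype.card V) k r) := by
  by_cases hvw : v = w
  · exact ⟨1, ⟨le_rfl, by omega⟩, le_max_of_le_left (hvw ▸ div_self_le_one _)⟩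
  · obtain ⟨r, x, hr, rfl, rfl, hadj, hinj⟩ := hG.exists_path_extending hvw hv
    have := card_univ_sdiff_path hinj le_rfl
    exact ⟨r, ⟨hr, by omega⟩, hG.steinerKDist_div_le hk (by omega) hkn hadj hinj⟩

end Bound
-- The comet attains the bound.
section Comet

open Finset

variable {n R : ℕ}

theorem comet_adj_iff (hR : 1 ≤ R) (i j : Fin n) : (comet n R).Adj i j ↔
    ((i : ℕ) + 1 = j ∧ (j : ℕ) < R) ∨ ((i : ℕ) = 0 ∧ R ≤ (j : ℕ)) ∨
      ((j : ℕ) + 1 = i ∧ (i : ℕ) < R) ∨ ((j : ℕ) = 0 ∧ R ≤ (i : ℕ)) := by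
  rw [comet, SimpleGraph.fromRel_adj, or_assoc, and_iff_right_iff_imp]
  rintro h rfl
  omega

/-- Besides connectedness, this bounds branches from above: a vertex missed by one walk from the
root to `j` does not have `j` in its branch. -/
theorem exists_walk_comet (hR : 1 ≤ R) (hn : 0 < n) (j : ℕ) (hj : j < n) :
    ∃ p : (comet n R).Walk ⟨0, hn⟩ ⟨j, hj⟩,
      ∀ u ∈ p.support, (u : ℕ) = j ∨ (u : ℕ) = 0 ∨ ((u : ℕ) < j ∧ j < R) := by
  induction j with
  | zero => exact ⟨.nil, by simp⟩
  | succ j ih =>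
    rcases Nat.lt_or_ge (j + 1) R with h | h
    · obtain ⟨p, hp⟩ := ih (by omega)
      refine ⟨p.concat ((comet_adj_iff hR _ _).2 (Or.inl ⟨rfl, h⟩)), fun u hu => ?_⟩
      rw [SimpleGraph.Walk.support_concat, List.mem_append, List.mem_singleton] at hu
      rcases hu with hu | rfl
      · have := hp u hu
        omega
      · exact Or.inl rfl
    · refine ⟨((comet_adj_iff hR _ _).2 (Or.inr (Or.inl ⟨rfl, h⟩))).toWalk, fun u hu => ?_⟩
      simp only [SimpleGraph.Walk.support_cons, SimpleGraph.Walk.support_nil, List.mem_cons,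
        List.not_mem_nil, or_false] at hu
      rcases hu with rfl | rfl
      · exact Or.inr (Or.inl rfl)
      · exact Or.inl rfl

theorem comet_isTree (hR : 1 ≤ R) (hn : 0 < n) : (comet n R).IsTree := by
  classical
  have hconn : (comet n R).Connected := by
    rw [SimpleGraph.connected_iff_exists_forall_reachable]
    exact ⟨⟨0, hn⟩, fun j => ⟨(exists_walk_comet hR hn j j.2).choose⟩⟩
  refine SimpleGraph.isTree_iff_connected_and_card.2
    ⟨hconn, le_antisymm ?_ hconn.card_vert_le_card_edgeSet_add_one⟩
  -- Every edge joins a nonzero vertex to its parent, so there are at most `n - 1` edges.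
  let par : Fin n → Fin n := fun j => if (j : ℕ) < R then ⟨j - 1, by omega⟩ else ⟨0, hn⟩
  have hsub : (comet n R).edgeSet ⊆
      ((univ.erase (⟨0, hn⟩ : Fin n)).image fun j => s(j, par j) : Finset (Sym2 (Fin n))) := by
    intro e he
    induction e with
    | _ i j =>
      rw [SimpleGraph.mem_edgeSet, comet_adj_iff hR] at he
      simp only [coe_image, Set.mem_image, mem_coe, mem_erase, mem_univ, and_true, ne_eq,
        Fin.ext_iff]
      have hi : ((i : ℕ) + 1 = j ∧ (j : ℕ) < R) ∨ ((i : ℕ) = 0 ∧ R ≤ (j : ℕ)) →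
          i = par j ∧ (j : ℕ) ≠ 0 := by
        intro h
        simp only [par, Fin.ext_iff]
        split_ifs <;> dsimp only <;> omega
      have hj : ((j : ℕ) + 1 = i ∧ (i : ℕ) < R) ∨ ((j : ℕ) = 0 ∧ R ≤ (i : ℕ)) →
          j = par i ∧ (i : ℕ) ≠ 0 := by
        intro h
        simp only [par, Fin.ext_iff]
        split_ifs <;> dsimp only <;> omega
      rw [← or_assoc] at he
      rcases he with he | he
      · obtain ⟨h, h0⟩ := hi he
        exact ⟨j, h0, by rw [← h, Sym2.eq_swap]⟩
      · obtain ⟨h, h0⟩ := hj he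
        exact ⟨i, h0, by rw [← h]⟩
  have h1 := Set.ncard_le_ncard hsub (Set.toFinite _)
  rw [Set.ncard_coe_finset] at h1
  have h2 := h1.trans card_image_le
  rw [card_erase_of_mem (mem_univ _), card_univ, Fintype.card_fin] at h2
  rw [Nat.card_coe_set_eq, Nat.card_fin]
  omega

/-- The path of the comet, as a sequence of vertices. -/
def cometPath (hn : 0 < n) (i : ℕ) : Fin n := ⟨min i (n - 1), by omega⟩

theorem cometPath_injOn (hn : 0 < n) {L : ℕ} (hL : L < n) :
    Set.InjOn (cometPath hn) (Set.Iic L) := by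
  intro i hi j hj h
  rw [Set.mem_Iic] at hi hj
  simp only [cometPath, Fin.mk.injEq] at h
  omega

theorem cometPath_adj (hn : 0 < n) (hR : R ≤ n) (i : ℕ) (hi : i + 1 < R) :
    (comet n R).Adj (cometPath hn i) (cometPath hn (i + 1)) := by
  rw [comet_adj_iff (by omega)]
  simp only [cometPath]
  omega

variable {r : ℕ}

theorem card_branch_comet_path (hn : 0 < n) (hr : r + 2 ≤ n) {i : ℕ} (hi : i ≤ r + 1)
    (hi1 : 1 ≤ i) :
    (branch (comet n (r + 2)) (cometPath hn 0) (cometPath hn i)).card = r + 2 - i := by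
  refine le_antisymm ?_ ((comet_isTree (by omega) hn).isAcyclic.le_card_branch_path
    (fun i h => cometPath_adj hn hr i (by omega)) (cometPath_injOn hn (by omega)) hi)
  have hsub : branch (comet n (r + 2)) (cometPath hn 0) (cometPath hn i) ⊆
      (Icc i (r + 1)).image (cometPath hn) := by
    intro u hu
    obtain ⟨p, hp⟩ := exists_walk_comet (R := r + 2) (by omega) hn u u.2
    have h := hp _ (mem_branch.1 hu p)
    simp only [cometPath] at h
    refine mem_image.2 ⟨u, mem_Icc.2 ?_, ?_⟩
    · omega
    · simp only [cometPath, Fin.ext_iff]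
      omega
  have h := (card_le_card hsub).trans card_image_le
  rw [Nat.card_Icc] at h
  omega

/-- The bound `r + 1` includes the far path end `b` among the leaves. -/
theorem card_branch_comet_of_leaf (hn : 0 < n) {u : Fin n} (hu : r + 1 ≤ (u : ℕ)) :
    (branch (comet n (r + 2)) (cometPath hn 0) u).card = 1 := by
  rw [card_eq_one]
  refine ⟨u, eq_singleton_iff_unique_mem.2 ⟨self_mem_branch _ _, fun y hy => ?_⟩⟩
  obtain ⟨p, hp⟩ := exists_walk_comet (R := r + 2) (by omega) hn y y.2
  have h := hp _ (mem_branch.1 hy p)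
  rw [Fin.ext_iff]
  omega

theorem steinerKDist_comet_start (hn : 0 < n) (hr : r + 2 ≤ n) (k : ℕ) :
    (steinerKDist (comet n (r + 2)) k (cometPath hn 0) : ℝ) = cometDen n k r := by
  have hinj := cometPath_injOn hn (show r < n by omega)
  rw [(comet_isTree (by omega) hn).steinerKDist_path_start k hinj le_rfl, cometDen,
    Fintype.card_fin]
  congr 1
  · refine sum_congr rfl fun i hi => ?_
    have := mem_range.1 hi
    rw [card_branch_comet_path hn hr (by omega) (by omega),
      show r + 2 - (i + 1) = r + 1 - i by omega]
  · have h := card_univ_sdiff_path hinj le_rfl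
    rw [Fintype.card_fin] at h
    have h' : ((univ \ (range (r + 1)).image (cometPath hn)).card : ℝ) = (n : ℝ) - (r + 1) := by
      rw [eq_sub_iff_add_eq]
      exact_mod_cast h
    rw [← h', ← nsmul_eq_mul, ← sum_const]
    refine sum_congr rfl fun u hu => ?_
    rw [card_branch_comet_of_leaf hn]
    by_contra hlt
    refine (mem_sdiff.1 hu).2 (mem_image.2 ⟨u, mem_range.2 (by omega), ?_⟩)
    simp only [cometPath, Fin.ext_iff]
    omega

theorem steinerKDist_comet_end (hn : 0 < n) (hr : r + 2 ≤ n) (k : ℕ) :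
    (steinerKDist (comet n (r + 2)) k (cometPath hn r) : ℝ) =
      cometDen n k r + cometNum n k r := by
  have hT := comet_isTree (R := r + 2) (by omega) hn
  rw [hT.steinerKDist_path k (fun i h => cometPath_adj hn hr i (by omega))
    (cometPath_injOn hn (show r < n by omega)) le_rfl, steinerKDist_comet_start hn hr, cometNum,
    Fintype.card_fin]
  congr 1
  refine sum_congr rfl fun i hi => ?_
  have := mem_range.1 hi
  rw [card_branch_comet_path hn hr (by omega) (by omega),
      show r + 2 - (i + 1) = r + 1 - i by omega]

theorem comet_steinerKDist_div {k : ℕ} (hk : 2 ≤ k) (hkn : k ≤ n) (hr : r + 2 ≤ n) :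
    (steinerKDist (comet n (r + 2)) k (cometC n (r + 2) ⟨by omega, hr⟩) : ℝ) /
      steinerKDist (comet n (r + 2)) k (cometD n (r + 2) ⟨by omega, hr⟩) = boundF n k r := by
  have hn : 0 < n := by omega
  have hc : cometC n (r + 2) ⟨by omega, hr⟩ = cometPath hn r := by
    simp only [cometC, cometPath, Fin.ext_iff]
    omega
  have hd : cometD n (r + 2) ⟨by omega, hr⟩ = cometPath hn 0 := by
    simp [cometD, cometPath]
  rw [hc, hd, steinerKDist_comet_start hn hr, steinerKDist_comet_end hn hr,
    boundF_eq (by omega) hk (by omega), add_div,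
    div_self (cometDen_pos (by omega) hk hkn (by omega)).ne']

theorem isInternal_of_adj {V : Type*} [Finite V] {G : SimpleGraph V} {v a b : V}
    (ha : G.Adj v a) (hb : G.Adj v b) (hab : a ≠ b) : IsInternal G v := by
  rw [IsInternal, ← Set.ncard_pair hab]
  exact Set.ncard_le_ncard (Set.pair_subset_iff.2 ⟨ha, hb⟩) (Set.toFinite _)

theorem isInternal_cometC (hr1 : 1 ≤ r) (hr : r + 2 ≤ n) :
    IsInternal (comet n (r + 2)) (cometC n (r + 2) ⟨by omega, hr⟩) := by
  refine isInternal_of_adj (a := ⟨r - 1, by omega⟩) (b := ⟨r + 1, by omega⟩) ?_ ?_ ?_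
  · rw [comet_adj_iff (by omega)]
    simp only [cometC]
    omega
  · rw [comet_adj_iff (by omega)]
    simp only [cometC]
    omega
  · rw [ne_eq, Fin.mk.injEq]
    omega

/-- For `r + 2 = n` the comet is a path with end `d`, so an attached leaf is required. -/
theorem isInternal_cometD (hr : r + 3 ≤ n) :
    IsInternal (comet n (r + 2)) (cometD n (r + 2) ⟨by omega, by omega⟩) := by
  refine isInternal_of_adj (a := ⟨1, by omega⟩) (b := ⟨r + 2, by omega⟩) ?_ ?_ ?_
  · exact (comet_adj_iff (by omega) _ _).2 (Or.inl ⟨rfl, by dsimp only; omega⟩)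
  · exact (comet_adj_iff (by omega) _ _).2 (Or.inr (Or.inl ⟨rfl, le_rfl⟩))
  · rw [ne_eq, Fin.mk.injEq]
    omega

end Comet

/-- The index `n - 2` can be discarded because `F(n - 2) ≤ 1 ≤ F(1)`. -/
theorem exists_isMaxOn_boundF {n k : ℕ} (hn : 4 ≤ n) (hk : 2 ≤ k) (hkn : k ≤ n) :
    ∃ r : ℕ, 1 ≤ r ∧ r ≤ n - 3 ∧ IsMaxOn (boundF n k) (Set.Icc 1 (n - 2)) r := by
  obtain ⟨r, hr, hmax⟩ := (Finset.Icc 1 (n - 3)).exists_max_image (boundF n k)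
    ⟨1, Finset.mem_Icc.2 ⟨le_rfl, by omega⟩⟩
  rw [Finset.mem_Icc] at hr
  refine ⟨r, hr.1, hr.2, isMaxOn_iff.2 fun j hj => ?_⟩
  rcases hj.2.lt_or_eq with h | rfl
  · exact hmax j (Finset.mem_Icc.2 ⟨hj.1, by omega⟩)
  · exact ((boundF_sub_two_le_one hn hk hkn).trans (one_le_boundF_one hn hk hkn)).trans
      (hmax 1 (Finset.mem_Icc.2 ⟨le_rfl, by omega⟩))

theorem mainTheorem3 (n k : ℕ) (hn : 4 ≤ n) (hk : 2 ≤ k) (hkn : k ≤ n) :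
    -- a maximiser exists, even one for which both vertices of the comet are internal
    (∃ r : ℕ, 1 ≤ r ∧ r ≤ n - 3 ∧ IsMaxOn (boundF n k) (Set.Icc 1 (n - 2)) r) ∧
    ∀ (r : ℕ) (hr1 : 1 ≤ r) (hr2 : r ≤ n - 2),
      IsMaxOn (boundF n k) (Set.Icc 1 (n - 2)) r →
      -- the bounds
      (∀ (V : Type*) [Fintype V] [DecidableEq V] (T : SimpleGraph V),
        T.IsTree → Fintype.card V = n →
        ∀ v w : V, IsInternal T v → IsInternal T w →
          0 < steinerKDist T k w ∧
          1 / boundF n k r ≤ (steinerKDist T k v : ℝ) / (steinerKDist T k w : ℝ) ∧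
          (steinerKDist T k v : ℝ) / (steinerKDist T k w : ℝ) ≤ boundF n k r) ∧
      -- the extremal comet
      (comet n (r + 2)).IsTree ∧
      (r ≤ n - 3 →
        IsInternal (comet n (r + 2)) (cometC n (r + 2) (by omega)) ∧
        IsInternal (comet n (r + 2)) (cometD n (r + 2) (by omega))) ∧
      (steinerKDist (comet n (r + 2)) k (cometC n (r + 2) (by omega)) : ℝ) /
          (steinerKDist (comet n (r + 2)) k (cometD n (r + 2) (by omega)) : ℝ)
        = boundF n k r ∧
      (steinerKDist (comet n (r + 2)) k (cometD n (r + 2) (by omega)) : ℝ) /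
          (steinerKDist (comet n (r + 2)) k (cometC n (r + 2) (by omega)) : ℝ)
        = 1 / boundF n k r := by
  refine ⟨exists_isMaxOn_boundF hn hk hkn, fun r hr1 hr2 hmax => ?_⟩
  have hr : r + 2 ≤ n := by omega
  have hF : 1 ≤ boundF n k r :=
    (one_le_boundF_one hn hk hkn).trans (hmax ⟨le_rfl, by omega⟩)
  refine ⟨?_, comet_isTree (by omega) (by omega),
    fun h => ⟨isInternal_cometC hr1 hr, isInternal_cometD (by omega)⟩,
    comet_steinerKDist_div hk hkn hr, ?_⟩
  · intro V _ _ T hT hV v w hv hw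
    have hpos := fun u => hT.steinerKDist_pos hk (by omega) (by omega) u
    have hle : ∀ a b : V, IsInternal T a →
        (steinerKDist T k a : ℝ) / steinerKDist T k b ≤ boundF n k r := by
      intro a b ha
      obtain ⟨j, hj, h⟩ := hT.exists_steinerKDist_div_le hk (by omega) (by omega) b ha
      rw [hV] at hj h
      exact h.trans (max_le hF (hmax hj))
    have hv' : (0 : ℝ) < steinerKDist T k v := by exact_mod_cast hpos v
    have hw' : (0 : ℝ) < steinerKDist T k w := by exact_mod_cast hpos w
    refine ⟨hpos w, ?_, hle v w hv⟩
    -- Inverting turns the lower bound into the upper bound for the swapped pair.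
    rw [one_div, inv_le_comm₀ (by linarith) (div_pos hv' hw'), inv_div]
    exact hle w v hw
  · rw [← comet_steinerKDist_div hk hkn hr, one_div, inv_div]
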